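/- Let $\mathcal H$ be a complex Hilbert space, let $k\ge 2$ be an integer with $k\le\dim\mathcal H$ ($\mathcal H$ may be infinite-dimensional), and let $c=(c_1,\dots,c_k)\in\mathbb R^k$ satisfy $c_1\ge c_2\ge\dots\ge c_k$ with not all $c_j$ equal. For a bounded linear operator $A$ on $\mathcal H$, let $$W_c(A)=\Big\{\sum_{j=1}^k c_j\langle Ae_j,e_j\rangle : e_1,\dots,e_k \text{ orthonormal in } \mathcal H\Big\}$$ be its $c$-numerical range. Let $T$ and $S$ be bounded linear operators on $\mathcal H$ of rank one with $W_c(T)=W_c(S)$, and let $\operatorname{tr}$ denote the trace of a finite-rank operator. Then: 1. if $c_1+c_k\neq 0$, then $\operatorname{tr}(T)=\operatorname{tr}(S)$; 2. if $c_1+c_k=0$, then $\operatorname{tr}(T)=\operatorname{tr}(S)$ or $\operatorname{tr}(T)=-\operatorname{tr}(S)$. -/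

import Mathlib

noncomputable section

/-- The `c`-numerical range of a bounded operator `A` on `H`, for `c = (c₁, …, c_k) ∈ ℝᵏ`: the set of
all `∑ⱼ cⱼ ⟨A eⱼ, eⱼ⟩`, where `e₁, …, e_k` runs through the orthonormal `k`-tuples of `H`.
The inner product of Mathlib is linear in its second argument, so `⟨A e, e⟩` is written
`inner ℂ e (A e)`. -/
def cNumericalRange {H : Type*} [NormedAddCommGroup H] [InnerProductSpace ℂ H] {k : ℕ}
    (c : Fin k → ℝ) (A : H →L[ℂ] H) : Set ℂ :=
  {z | ∃ e : Fin k → H, Orthonormal ℂ e ∧ z = ∑ j, (c j : ℂ) * inner ℂ (e j) (A (e j))}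

/-- The trace of a finite-rank operator `T` on a space of any dimension: the trace of the
endomorphism `v ↦ T v` that `T` induces on its own (finite-dimensional) range. -/
def finiteRankTrace {H : Type*} [NormedAddCommGroup H] [InnerProductSpace ℂ H]
    (T : H →L[ℂ] H) : ℂ :=
  LinearMap.trace ℂ (LinearMap.range (T : H →ₗ[ℂ] H))
    ((T : H →ₗ[ℂ] H).rangeRestrict ∘ₗ (LinearMap.range (T : H →ₗ[ℂ] H)).subtype)

/-- The operator `v ↦ ⟨v, f⟩ x` has trace `⟨x, f⟩`. -/
theorem finiteRankTrace_rankOne {H : Type*} [NormedAddCommGroup H] [InnerProductSpace ℂ H]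
    (x f : H) : finiteRankTrace (InnerProductSpace.rankOne ℂ x f) = inner ℂ f x := by
  have hz : ∀ T : H →L[ℂ] H, T = 0 → finiteRankTrace T = 0 := by
    rintro T rfl
    have h0 : ((0 : H →L[ℂ] H) : H →ₗ[ℂ] H).rangeRestrict ∘ₗ
        (LinearMap.range ((0 : H →L[ℂ] H) : H →ₗ[ℂ] H)).subtype = 0 := by
      ext v; simp
    rw [finiteRankTrace, h0, map_zero]
  by_cases hx : x = 0
  · subst hx; rw [hz _ (by simp)]; simp
  by_cases hf : f = 0
  · subst hf; rw [hz _ (by simp)]; simp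
  set T : H →L[ℂ] H := InnerProductSpace.rankOne ℂ x f with hT
  have hff : inner ℂ f f ≠ 0 := by simpa using hf
  have hmem : x ∈ LinearMap.range (T : H →ₗ[ℂ] H) :=
    ⟨(inner ℂ f f)⁻¹ • f, by simp [hT, hf]⟩
  have hle : LinearMap.range (T : H →ₗ[ℂ] H) ≤ Submodule.span ℂ {x} := by
    rintro _ ⟨v, rfl⟩
    exact Submodule.mem_span_singleton.2 ⟨inner ℂ f v, by simp [hT]⟩
  have : FiniteDimensional ℂ (LinearMap.range (T : H →ₗ[ℂ] H)) :=
    Submodule.finiteDimensional_of_le hle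
  have hE : (T : H →ₗ[ℂ] H).rangeRestrict ∘ₗ (LinearMap.range (T : H →ₗ[ℂ] H)).subtype =
      ((innerSL ℂ f : H →ₗ[ℂ] ℂ) ∘ₗ (LinearMap.range (T : H →ₗ[ℂ] H)).subtype).smulRight
        (⟨x, hmem⟩ : LinearMap.range (T : H →ₗ[ℂ] H)) := by
    ext v; simp [hT]
  rw [finiteRankTrace, hE, LinearMap.trace_smulRight]
  simp

/-- For a rank-one operator the trace is `∑ᵢ ⟨T bᵢ, bᵢ⟩` for every orthonormal basis `b`. -/
theorem hasSum_finiteRankTrace {H : Type*} [NormedAddCommGroup H] [InnerProductSpace ℂ H]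
    [CompleteSpace H] {ι : Type*} (b : HilbertBasis ι ℂ H) (T : H →L[ℂ] H)
    (hT : LinearMap.rank (T : H →ₗ[ℂ] H) = 1) :
    HasSum (fun i => inner ℂ (b i) (T (b i))) (finiteRankTrace T) := by
  obtain ⟨⟨x, hx⟩, hne, hspan⟩ := rank_eq_one_iff.1 hT
  have hx0 : x ≠ 0 := fun h => hne (Subtype.ext h)
  have hxx : inner ℂ x x ≠ 0 := by simpa using hx0
  have hT' : T = InnerProductSpace.rankOne ℂ x ((inner ℂ x x)⁻¹ • T.adjoint x) := by
    ext v
    obtain ⟨r, hr⟩ := hspan ⟨T v, ⟨v, rfl⟩⟩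
    have hr' : r • x = T v := congrArg Subtype.val hr
    simp only [InnerProductSpace.rankOne_apply, inner_smul_left,
      ContinuousLinearMap.adjoint_inner_left, ← hr', inner_smul_right]
    congr 1
    simp only [map_inv₀, inner_conj_symm]
    field_simp
  rw [hT', finiteRankTrace_rankOne]
  generalize (inner ℂ x x)⁻¹ • T.adjoint x = f
  have := b.hasSum_inner_mul_inner f x
  simpa [InnerProductSpace.rankOne_apply, inner_smul_right] using this

end

/-! Write T = `rankOne x f`, with trace τ = `inner ℂ f x`. The real part of aT is a difference of
two squared coordinates along orthogonal vectors u, v. Weighted sums of squared coordinates have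
sharp bounds g‖u‖² and l‖v‖², attained together because u ⟂ v. So the support function of
`cNumericalRange c T` in direction a is (g+l)/2 · Re(aτ) + (g-l)/2 · √(‖a‖²‖x‖²‖f‖² - Im(aτ)²)
(`isGreatest_re_mul_cNumericalRange_rankOne`). If g + l ≠ 0, its odd part in a determines τ;
otherwise its even part determines τ². -/

/-! ### Orthonormal families through given orthogonal vectors -/

/-- Finitely many pairwise orthogonal vectors, zero allowed, are non-negative multiples of the
members of an orthonormal family. -/
theorem exists_orthonormal_norm_smul_eq {H : Type*} [NormedAddCommGroup H]
    [InnerProductSpace ℂ H] {n : ℕ} (hn : (n : Cardinal) ≤ Module.rank ℂ H) (w : Fin n → H)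
    (hw : Pairwise fun i j => inner ℂ (w i) (w j) = 0) :
    ∃ e : Fin n → H, Orthonormal ℂ e ∧ ∀ i, w i = (‖w i‖ : ℂ) • e i := by
  obtain ⟨l, hl⟩ := Module.le_rank_iff.1 hn
  let M : Submodule ℂ H := Submodule.span ℂ (Set.range w ∪ Set.range l)
  have : FiniteDimensional ℂ M :=
    FiniteDimensional.span_of_finite ℂ ((Set.finite_range w).union (Set.finite_range l))
  have hwM : ∀ i, w i ∈ M := fun i => Submodule.subset_span (Or.inl ⟨i, rfl⟩)
  have hlM : ∀ i, l i ∈ M := fun i => Submodule.subset_span (Or.inr ⟨i, rfl⟩)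
  have hnM : n ≤ Module.finrank ℂ M := by
    have h : LinearIndependent ℂ fun i => (⟨l i, hlM i⟩ : M) :=
      LinearIndependent.of_comp M.subtype hl
    simpa using h.fintype_card_le_finrank
  -- The index type has exactly dim M elements, as the extension to a basis demands; the values of
  -- `v` outside `s` are placeholders.
  let v : Fin n ⊕ Fin (Module.finrank ℂ M - n) → M :=
    Sum.elim (fun i => ((‖w i‖ : ℂ)⁻¹) • ⟨w i, hwM i⟩) 0
  let s : Set (Fin n ⊕ Fin (Module.finrank ℂ M - n)) := {x | ∃ i, x = Sum.inl i ∧ w i ≠ 0}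
  have hv : Orthonormal ℂ (s.domRestrict v) := by
    constructor
    · rintro ⟨_, i, rfl, hi⟩
      simp [v, norm_smul, hi]
    · rintro ⟨_, i, rfl, hi⟩ ⟨_, j, rfl, hj⟩ hij
      have hij' : i ≠ j := by rintro rfl; exact hij rfl
      simp [v, inner_smul_left, inner_smul_right, hw hij']
  obtain ⟨b, hb⟩ := Orthonormal.exists_orthonormalBasis_extension_of_card_eq
    (by simp; omega) hv
  refine ⟨fun i => (b (Sum.inl i) : H), ?_, fun i => ?_⟩
  · exact (b.orthonormal.comp Sum.inl Sum.inl_injective).comp_linearIsometry M.subtypeₗᵢ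
  · by_cases hi : w i = 0
    · simp [hi]
    · have hi' : (‖w i‖ : ℂ) ≠ 0 := by simpa using hi
      dsimp only
      rw [hb (Sum.inl i) ⟨i, rfl, hi⟩]
      simp [v, hi']

/-- Parseval's identity for an orthonormal family whose length is the dimension. -/
theorem sum_norm_inner_sq_of_rank_eq {H : Type*} [NormedAddCommGroup H]
    [InnerProductSpace ℂ H] {k : ℕ} (hk : Module.rank ℂ H = k) {e : Fin k → H}
    (he : Orthonormal ℂ e) (u : H) : ∑ j, ‖inner ℂ (e j) u‖ ^ 2 = ‖u‖ ^ 2 := by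
  have : FiniteDimensional ℂ H :=
    Module.finite_of_rank_eq_nat hk
  have hs := he.linearIndependent.span_eq_top_of_card_eq_finrank'
    (by simp [Module.finrank_eq_of_rank_eq hk])
  simpa using (OrthonormalBasis.mk he hs.ge).sum_sq_norm_inner_right u

/-! ### Sharp bounds for weighted sums of squared coordinates -/

/-- Bessel's inequality suffices when g ≥ 0; a negative g needs the equality of Parseval, hence a
family that fills the space. -/
theorem sum_mul_norm_inner_sq_le {H : Type*} [NormedAddCommGroup H]
    [InnerProductSpace ℂ H] {k : ℕ} {c : Fin k → ℝ} {g : ℝ} (hc : ∀ j, c j ≤ g)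
    (hg : Module.rank ℂ H = k ∨ 0 ≤ g) {e : Fin k → H} (he : Orthonormal ℂ e) (u : H) :
    ∑ j, c j * ‖inner ℂ (e j) u‖ ^ 2 ≤ g * ‖u‖ ^ 2 := by
  have h1 : ∑ j, c j * ‖inner ℂ (e j) u‖ ^ 2 ≤ g * ∑ j, ‖inner ℂ (e j) u‖ ^ 2 := by
    rw [Finset.mul_sum]
    exact Finset.sum_le_sum fun j _ => mul_le_mul_of_nonneg_right (hc j) (sq_nonneg _)
  rcases hg with hk | hg
  · rwa [sum_norm_inner_sq_of_rank_eq hk he] at h1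
  · exact h1.trans (mul_le_mul_of_nonneg_left (he.sum_inner_products_le u) hg)

theorem le_sum_mul_norm_inner_sq {H : Type*} [NormedAddCommGroup H]
    [InnerProductSpace ℂ H] {k : ℕ} {c : Fin k → ℝ} {g : ℝ} (hc : ∀ j, g ≤ c j)
    (hg : Module.rank ℂ H = k ∨ g ≤ 0) {e : Fin k → H} (he : Orthonormal ℂ e) (u : H) :
    g * ‖u‖ ^ 2 ≤ ∑ j, c j * ‖inner ℂ (e j) u‖ ^ 2 := by
  have := sum_mul_norm_inner_sq_le (c := fun j => -c j) (g := -g) (fun j => neg_le_neg (hc j))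
    (hg.imp_right neg_nonneg.2) he u
  simp only [neg_mul, Finset.sum_neg_distrib] at this
  linarith

/-- The weighted sum of squared coordinates for a multiple of a member of an orthonormal family
from which `e` is selected. -/
theorem sum_mul_norm_inner_sq_comp {H : Type*} [NormedAddCommGroup H]
    [InnerProductSpace ℂ H] {k n : ℕ} (c : Fin k → ℝ) {b : Fin n → H} (hb : Orthonormal ℂ b)
    (φ : Fin k → Fin n) {u : H} {i : Fin n} (hu : u = (‖u‖ : ℂ) • b i) :
    ∑ j, c j * ‖inner ℂ (b (φ j)) u‖ ^ 2 = (∑ j, if φ j = i then c j else 0) * ‖u‖ ^ 2 := by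
  rw [Finset.sum_mul]
  refine Finset.sum_congr rfl fun j _ => ?_
  have : ‖inner ℂ (b (φ j)) u‖ = if φ j = i then ‖u‖ else 0 := by
    conv_lhs => rw [hu]
    rw [inner_smul_right, orthonormal_iff_ite.1 hb]
    split_ifs <;> simp
  rw [this]
  split_ifs <;> simp

/-- Two orthogonal vectors are multiples of the first and the last member of an orthonormal
family. -/
theorem exists_orthonormal_ends {H : Type*} [NormedAddCommGroup H]
    [InnerProductSpace ℂ H] {n : ℕ} (hn : (n : Cardinal) ≤ Module.rank ℂ H) {i j : Fin n}
    (hij : i ≠ j) {u v : H} (huv : inner ℂ u v = 0) :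
    ∃ b : Fin n → H, Orthonormal ℂ b ∧ u = (‖u‖ : ℂ) • b i ∧ v = (‖v‖ : ℂ) • b j := by
  obtain ⟨b, hb, hw⟩ := exists_orthonormal_norm_smul_eq hn
    (fun l => if l = i then u else if l = j then v else 0) (by
      intro a b hab
      have hvu : inner ℂ v u = 0 := inner_eq_zero_symm.1 huv
      split_ifs with h1 h2 h3 <;> simp_all)
  exact ⟨b, hb, by simpa using hw i, by simpa [hij.symm] using hw j⟩

/-- The extreme weights of `c`, completed by zeros to a sequence of length `dim H`: the sharp
bounds for the weighted sums of squared coordinates, attained simultaneously. -/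
theorem exists_extreme_weights {H : Type*} [NormedAddCommGroup H] [InnerProductSpace ℂ H]
    {m : ℕ} (hdim : ((m + 1 : ℕ) : Cardinal) ≤ Module.rank ℂ H)
    (c : Fin (m + 1) → ℝ) (hc : Antitone c) (hlt : c (Fin.last m) < c 0) :
    ∃ g l : ℝ, (g + l = 0 ↔ c 0 + c (Fin.last m) = 0) ∧ l < g ∧
      (∀ e : Fin (m + 1) → H, Orthonormal ℂ e → ∀ u,
        ∑ j, c j * ‖inner ℂ (e j) u‖ ^ 2 ≤ g * ‖u‖ ^ 2) ∧
      (∀ e : Fin (m + 1) → H, Orthonormal ℂ e → ∀ u,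
        l * ‖u‖ ^ 2 ≤ ∑ j, c j * ‖inner ℂ (e j) u‖ ^ 2) ∧
      ∀ u v : H, inner ℂ u v = 0 → ∃ e : Fin (m + 1) → H, Orthonormal ℂ e ∧
        ∑ j, c j * ‖inner ℂ (e j) u‖ ^ 2 = g * ‖u‖ ^ 2 ∧
        ∑ j, c j * ‖inner ℂ (e j) v‖ ^ 2 = l * ‖v‖ ^ 2 := by
  have hmax : ∀ j, c j ≤ c 0 := fun j => hc (Fin.zero_le j)
  have hmin : ∀ j, c (Fin.last m) ≤ c j := fun j => hc (Fin.le_last j)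
  have h0l : (0 : Fin (m + 1)) ≠ Fin.last m := by
    rintro h; rw [← h] at hlt; exact lt_irrefl _ hlt
  have attain : ∀ u v : H, inner ℂ u v = 0 → ∃ e : Fin (m + 1) → H, Orthonormal ℂ e ∧
      ∑ j, c j * ‖inner ℂ (e j) u‖ ^ 2 = c 0 * ‖u‖ ^ 2 ∧
      ∑ j, c j * ‖inner ℂ (e j) v‖ ^ 2 = c (Fin.last m) * ‖v‖ ^ 2 := by
    intro u v huv
    obtain ⟨b, hb, hu, hv⟩ := exists_orthonormal_ends hdim h0l huv
    exact ⟨b, hb, by simpa using sum_mul_norm_inner_sq_comp c hb id hu,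
      by simpa using sum_mul_norm_inner_sq_comp c hb id hv⟩
  by_cases hr : Module.rank ℂ H = (m + 1 : ℕ)
  · exact ⟨c 0, c (Fin.last m), Iff.rfl, hlt,
      fun e he u => sum_mul_norm_inner_sq_le hmax (Or.inl hr) he u,
      fun e he u => le_sum_mul_norm_inner_sq hmin (Or.inl hr) he u, attain⟩
  have hdim' : ((m + 2 : ℕ) : Cardinal) ≤ Module.rank ℂ H := by
    have h := Order.succ_le_of_lt (lt_of_le_of_ne hdim (Ne.symm hr))
    rwa [Cardinal.succ_natCast, ← Nat.cast_add_one] at h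
  have h0l' : (0 : Fin (m + 2)) ≠ Fin.last (m + 1) := (Fin.last_pos).ne
  -- There is a spare dimension, so a vector can be orthogonal to all `e j`: the weight 0 is
  -- available too.
  refine ⟨max (c 0) 0, min (c (Fin.last m)) 0, ?_, ?_,
    fun e he u => sum_mul_norm_inner_sq_le (fun j => le_max_of_le_left (hmax j))
      (Or.inr (le_max_right _ _)) he u,
    fun e he u => le_sum_mul_norm_inner_sq (fun j => min_le_of_left_le (hmin j))
      (Or.inr (min_le_right _ _)) he u, ?_⟩
  · rcases max_cases (c 0) 0 with ⟨h1, h1'⟩ | ⟨h1, h1'⟩ <;>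
    rcases min_cases (c (Fin.last m)) 0 with ⟨h2, h2'⟩ | ⟨h2, h2'⟩ <;>
    rw [h1, h2] <;> constructor <;> intro h <;> linarith
  · exact (min_le_left _ _).trans_lt (hlt.trans_le (le_max_left _ _))
  intro u v huv
  rcases le_or_gt (c 0) 0 with hc0 | hc0
  · obtain ⟨b, hb, hu, hv⟩ := exists_orthonormal_ends hdim' h0l' huv
    -- Omitting `b 0`, the direction of u, gives u the weight 0.
    refine ⟨b ∘ Fin.succ, hb.comp _ (Fin.succ_injective _), ?_, ?_⟩
    · rw [max_eq_right hc0]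
      simpa using sum_mul_norm_inner_sq_comp c hb Fin.succ hu
    · rw [min_eq_left (hlt.le.trans hc0)]
      simpa [← Fin.succ_last] using sum_mul_norm_inner_sq_comp c hb Fin.succ hv
  rcases le_or_gt 0 (c (Fin.last m)) with hcl | hcl
  · obtain ⟨b, hb, hu, hv⟩ := exists_orthonormal_ends hdim' h0l' huv
    -- Dually, the direction of v is omitted.
    refine ⟨b ∘ Fin.castSucc, hb.comp _ (Fin.castSucc_injective _), ?_, ?_⟩
    · rw [max_eq_left hc0.le]
      simpa using sum_mul_norm_inner_sq_comp c hb Fin.castSucc hu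
    · rw [min_eq_right hcl]
      simpa [(Fin.castSucc_lt_last _).ne] using sum_mul_norm_inner_sq_comp c hb Fin.castSucc hv
  rw [max_eq_left hc0.le, min_eq_left hcl.le]
  exact attain u v huv

/-! ### Diagonalising the real part of a rank-one operator -/

/-- The quadratic form of the real part of `rankOne x f` as a difference of squared coordinates
along two orthogonal vectors, in the case of a real inner product of `f` and `x`. -/
theorem exists_orthogonal_re_inner_mul_inner_of_im_eq_zero {H : Type*} [NormedAddCommGroup H]
    [InnerProductSpace ℂ H] (x f : H) (hxf : (inner ℂ f x).im = 0) (hx : x ≠ 0) (hf : f ≠ 0) :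
    ∃ u v : H, inner ℂ u v = 0 ∧
      (∀ e : H, (inner ℂ e x * inner ℂ f e).re = ‖inner ℂ e u‖ ^ 2 - ‖inner ℂ e v‖ ^ 2) ∧
      ‖u‖ ^ 2 - ‖v‖ ^ 2 = (inner ℂ f x).re ∧ ‖u‖ ^ 2 + ‖v‖ ^ 2 = ‖x‖ * ‖f‖ := by
  -- This scaling gives y and g equal norms; as their inner product is real, y + g ⟂ y - g, and
  -- polarization yields the form.
  set r : ℝ := √(‖f‖ / ‖x‖) with hr
  have hx' : 0 < ‖x‖ := norm_pos_iff.2 hx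
  have hf' : 0 < ‖f‖ := norm_pos_iff.2 hf
  have hr2 : r ^ 2 = ‖f‖ / ‖x‖ := Real.sq_sqrt (by positivity)
  have hr0 : 0 < r := Real.sqrt_pos.2 (by positivity)
  have hconj : inner ℂ x f = inner ℂ f x := by
    rw [← inner_conj_symm]
    exact Complex.conj_eq_iff_im.2 hxf
  set y : H := ((r / 2 : ℝ) : ℂ) • x with hy
  set g : H := ((r⁻¹ / 2 : ℝ) : ℂ) • f with hg
  have hyy : ‖y‖ ^ 2 = ‖x‖ * ‖f‖ / 4 := by
    rw [hy, norm_smul, Complex.norm_real, Real.norm_of_nonneg (by positivity), mul_pow, div_pow,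
      hr2]
    field_simp; norm_num
  have hgg : ‖g‖ ^ 2 = ‖x‖ * ‖f‖ / 4 := by
    rw [hg, norm_smul, Complex.norm_real, Real.norm_of_nonneg (by positivity), mul_pow, div_pow,
      inv_pow, hr2]
    field_simp; norm_num
  have hrr : ((r / 2 : ℝ) : ℂ) * ((r⁻¹ / 2 : ℝ) : ℂ) = 1 / 4 := by
    have : (r : ℂ) ≠ 0 := by exact_mod_cast hr0.ne'
    push_cast; field_simp; norm_num
  have hyg : inner ℂ y g = inner ℂ f x / 4 := by
    rw [hy, hg, inner_smul_left, inner_smul_right, Complex.conj_ofReal, ← mul_assoc, hrr, hconj]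
    ring
  have hgy : inner ℂ g y = inner ℂ f x / 4 := by
    rw [hy, hg, inner_smul_left, inner_smul_right, Complex.conj_ofReal, ← mul_assoc,
      mul_comm (((r⁻¹ / 2 : ℝ) : ℂ)), hrr]
    ring
  have hre : (inner ℂ y g).re = (inner ℂ f x).re / 4 := by
    rw [hyg]; simp
  have hadd : ‖y + g‖ ^ 2 = ‖y‖ ^ 2 + 2 * (inner ℂ y g).re + ‖g‖ ^ 2 := norm_add_sq (𝕜 := ℂ) y g
  have hsub : ‖y - g‖ ^ 2 = ‖y‖ ^ 2 - 2 * (inner ℂ y g).re + ‖g‖ ^ 2 := norm_sub_sq (𝕜 := ℂ) y g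
  refine ⟨y + g, y - g, ?_, fun e => ?_, ?_, ?_⟩
  · rw [inner_sub_right, inner_add_left, inner_add_left, hyg, hgy,
      inner_self_eq_norm_sq_to_K, inner_self_eq_norm_sq_to_K]
    have : ((‖y‖ : ℂ)) ^ 2 = (‖g‖ : ℂ) ^ 2 := by
      exact_mod_cast hyy.trans hgg.symm
    simp only [Complex.coe_algebraMap, this]
    ring
  · have h1 : inner ℂ e x * inner ℂ f e = 4 * (inner ℂ e y * (starRingEnd ℂ) (inner ℂ e g)) := by
      rw [inner_conj_symm, hy, hg, inner_smul_left, inner_smul_right, Complex.conj_ofReal]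
      linear_combination (-4 * inner ℂ e x * inner ℂ f e) * hrr
    rw [h1, inner_add_right, inner_sub_right, ← Complex.normSq_eq_norm_sq,
      ← Complex.normSq_eq_norm_sq, Complex.normSq_add, Complex.normSq_sub]
    simp only [Complex.mul_re, Complex.re_ofNat, Complex.im_ofNat]
    ring
  · rw [hadd, hsub, hre]; ring
  · rw [hadd, hsub, hyy, hgg]; ring

/-- The quadratic form of the real part of `rankOne x f` as a difference of squared coordinates
along two orthogonal vectors. -/
theorem exists_orthogonal_re_inner_mul_inner {H : Type*} [NormedAddCommGroup H]
    [InnerProductSpace ℂ H] (x f : H) (hx : x ≠ 0) :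
    ∃ u v : H, inner ℂ u v = 0 ∧
      (∀ e : H, (inner ℂ e x * inner ℂ f e).re = ‖inner ℂ e u‖ ^ 2 - ‖inner ℂ e v‖ ^ 2) ∧
      ‖u‖ ^ 2 - ‖v‖ ^ 2 = (inner ℂ f x).re ∧
      ‖u‖ ^ 2 + ‖v‖ ^ 2 = √(‖x‖ ^ 2 * ‖f‖ ^ 2 - (inner ℂ f x).im ^ 2) := by
  -- Adding i s x to f changes the form by a purely imaginary term only; s is chosen to make the
  -- inner product with x real.
  have hx' : ‖x‖ ≠ 0 := norm_ne_zero_iff.2 hx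
  set s : ℝ := (inner ℂ f x).im / ‖x‖ ^ 2 with hs
  set g : H := f + (Complex.I * s) • x with hg
  have hgx : ∀ e : H, inner ℂ g e = inner ℂ f e - Complex.I * s * inner ℂ x e := by
    intro e
    rw [hg, inner_add_left, inner_smul_left]
    simp; ring
  have hxx : inner ℂ x x = ((‖x‖ ^ 2 : ℝ) : ℂ) := by
    rw [inner_self_eq_norm_sq_to_K]; simp
  have hgx0 : inner ℂ g x = ((inner ℂ f x).re : ℂ) := by
    rw [hgx, hxx, mul_assoc, ← Complex.ofReal_mul, hs, div_mul_cancel₀ _ (pow_ne_zero 2 hx')]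
    apply Complex.ext <;> simp
  have hform : ∀ e : H, (inner ℂ e x * inner ℂ g e).re = (inner ℂ e x * inner ℂ f e).re := by
    intro e
    have : inner ℂ e x * inner ℂ x e = ((‖inner ℂ e x‖ ^ 2 : ℝ) : ℂ) := by
      rw [← inner_conj_symm x e, Complex.mul_conj, Complex.normSq_eq_norm_sq]
    rw [hgx, mul_sub, show inner ℂ e x * (Complex.I * s * inner ℂ x e) =
      Complex.I * ((s * ‖inner ℂ e x‖ ^ 2 : ℝ) : ℂ) by
        rw [Complex.ofReal_mul, ← this]; ring]
    rw [Complex.sub_re, Complex.I_mul_re, Complex.ofReal_im, neg_zero, sub_zero]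
  have hnorm : ‖x‖ ^ 2 * ‖f‖ ^ 2 - (inner ℂ f x).im ^ 2 = (‖x‖ * ‖g‖) ^ 2 := by
    have h1 : ‖g‖ ^ 2 = ‖f‖ ^ 2 + 2 * (inner ℂ f ((Complex.I * s) • x)).re
        + ‖(Complex.I * s) • x‖ ^ 2 := norm_add_sq (𝕜 := ℂ) f _
    have h2 : (inner ℂ f ((Complex.I * s) • x)).re = - (s * (inner ℂ f x).im) := by
      rw [inner_smul_right]; simp
    have h3 : ‖(Complex.I * s) • x‖ ^ 2 = s ^ 2 * ‖x‖ ^ 2 := by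
      rw [norm_smul, mul_pow]; simp
    rw [mul_pow, h1, h2, h3, hs]
    field_simp
    ring
  rw [hnorm, Real.sqrt_sq (by positivity)]
  by_cases hg0 : g = 0
  · refine ⟨0, 0, by simp, fun e => ?_, ?_, by simp [hg0]⟩
    · rw [← hform, hg0]; simp
    · have : (inner ℂ f x).re = (inner ℂ g x).re := by rw [hgx0]; simp
      rw [this, hg0]; simp
  obtain ⟨u, v, h1, h2, h3, h4⟩ := exists_orthogonal_re_inner_mul_inner_of_im_eq_zero x g
    (by rw [hgx0]; simp) hx hg0
  refine ⟨u, v, h1, fun e => ?_, ?_, h4⟩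
  · rw [← h2, hform]
  · rw [h3, hgx0]; simp

/-! ### Support function and conclusion -/

/-- The support function of the `c`-numerical range of a rank-one operator. -/
theorem isGreatest_re_mul_cNumericalRange_rankOne {H : Type*} [NormedAddCommGroup H]
    [InnerProductSpace ℂ H] {k : ℕ} {c : Fin k → ℝ} {g l : ℝ}
    (hg : ∀ e : Fin k → H, Orthonormal ℂ e → ∀ u,
      ∑ j, c j * ‖inner ℂ (e j) u‖ ^ 2 ≤ g * ‖u‖ ^ 2)
    (hl : ∀ e : Fin k → H, Orthonormal ℂ e → ∀ u,
      l * ‖u‖ ^ 2 ≤ ∑ j, c j * ‖inner ℂ (e j) u‖ ^ 2)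
    (hgl : ∀ u v : H, inner ℂ u v = 0 → ∃ e : Fin k → H, Orthonormal ℂ e ∧
      ∑ j, c j * ‖inner ℂ (e j) u‖ ^ 2 = g * ‖u‖ ^ 2 ∧
      ∑ j, c j * ‖inner ℂ (e j) v‖ ^ 2 = l * ‖v‖ ^ 2)
    {x f : H} (hx : x ≠ 0) {a : ℂ} (ha : a ≠ 0) :
    IsGreatest ((fun z => (a * z).re) '' cNumericalRange c (InnerProductSpace.rankOne ℂ x f))
      ((g + l) / 2 * (a * inner ℂ f x).re + (g - l) / 2 *
        √(‖a‖ ^ 2 * (‖x‖ ^ 2 * ‖f‖ ^ 2) - (a * inner ℂ f x).im ^ 2)) := by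
  obtain ⟨u, v, huv, hform, hsub, hadd⟩ :=
    exists_orthogonal_re_inner_mul_inner (a • x) f (smul_ne_zero ha hx)
  rw [inner_smul_right] at hsub hadd
  rw [norm_smul, mul_pow, mul_assoc] at hadd
  have hval : ∀ e : Fin k → H,
      (a * ∑ j, (c j : ℂ) * inner ℂ (e j) (InnerProductSpace.rankOne ℂ x f (e j))).re =
      ∑ j, c j * ‖inner ℂ (e j) u‖ ^ 2 - ∑ j, c j * ‖inner ℂ (e j) v‖ ^ 2 := by
    intro e
    rw [Finset.mul_sum, Complex.re_sum, ← Finset.sum_sub_distrib]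
    refine Finset.sum_congr rfl fun j _ => ?_
    rw [← mul_sub, ← hform, ← Complex.re_ofReal_mul, InnerProductSpace.rankOne_apply,
      inner_smul_right, inner_smul_right]
    congr 1
    ring
  rw [← hsub, ← hadd]
  constructor
  · obtain ⟨e, he, h1, h2⟩ := hgl u v huv
    refine ⟨_, ⟨e, he, rfl⟩, ?_⟩
    dsimp only
    rw [hval, h1, h2]
    ring
  · rintro _ ⟨_, ⟨e, he, rfl⟩, rfl⟩
    dsimp only
    rw [hval]
    linarith [hg e he u, hl e he v]

/-- An operator of rank one is `rankOne x f` for some vectors `x ≠ 0` and `f`. -/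
theorem exists_eq_rankOne_of_rank_eq_one {H : Type*} [NormedAddCommGroup H]
    [InnerProductSpace ℂ H] [CompleteSpace H] (T : H →L[ℂ] H)
    (hT : LinearMap.rank (T : H →ₗ[ℂ] H) = 1) :
    ∃ x f : H, x ≠ 0 ∧ T = InnerProductSpace.rankOne ℂ x f := by
  obtain ⟨⟨x, hx⟩, hne, hspan⟩ := rank_eq_one_iff.1 hT
  have hx0 : x ≠ 0 := fun h => hne (Subtype.ext h)
  have hxx : inner ℂ x x ≠ 0 := by simpa using hx0
  refine ⟨x, (inner ℂ x x)⁻¹ • T.adjoint x, hx0, ?_⟩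
  ext v
  obtain ⟨r, hr⟩ := hspan ⟨T v, ⟨v, rfl⟩⟩
  have hr' : r • x = T v := congrArg Subtype.val hr
  simp only [InnerProductSpace.rankOne_apply, inner_smul_left,
    ContinuousLinearMap.adjoint_inner_left, ← hr', inner_smul_right]
  congr 1
  simp only [map_inv₀, inner_conj_symm]
  field_simp

theorem proposition2p5 {H : Type*} [NormedAddCommGroup H] [InnerProductSpace ℂ H]
    [CompleteSpace H] {k : ℕ} (hk : 2 ≤ k) (hdim : (k : Cardinal) ≤ Module.rank ℂ H)
    (c : Fin k → ℝ) (hc_anti : Antitone c) (hc_ne : ∃ i j, c i ≠ c j)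
    (T S : H →L[ℂ] H)
    (hT : LinearMap.rank (T : H →ₗ[ℂ] H) = 1) (hS : LinearMap.rank (S : H →ₗ[ℂ] H) = 1)
    (hW : cNumericalRange c T = cNumericalRange c S) :
    (c ⟨0, by omega⟩ + c ⟨k - 1, by omega⟩ ≠ 0 → finiteRankTrace T = finiteRankTrace S) ∧
    (c ⟨0, by omega⟩ + c ⟨k - 1, by omega⟩ = 0 →
      finiteRankTrace T = finiteRankTrace S ∨ finiteRankTrace T = -finiteRankTrace S) := by
  obtain ⟨m, rfl⟩ : ∃ m, k = m + 1 := ⟨k - 1, by omega⟩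
  change (c 0 + c (Fin.last m) ≠ 0 → _) ∧ (c 0 + c (Fin.last m) = 0 → _)
  have hlt : c (Fin.last m) < c 0 := by
    by_contra! hle
    have h : ∀ i, c i = c 0 := fun i =>
      le_antisymm (hc_anti (Fin.zero_le i)) (hle.trans (hc_anti (Fin.le_last i)))
    obtain ⟨i, j, hij⟩ := hc_ne
    exact hij ((h i).trans (h j).symm)
  obtain ⟨x, f, hx, rfl⟩ := exists_eq_rankOne_of_rank_eq_one T hT
  obtain ⟨y, h, hy, rfl⟩ := exists_eq_rankOne_of_rank_eq_one S hS
  obtain ⟨g, l, hiff, hgl, h1, h2, h3⟩ := exists_extreme_weights hdim c hc_anti hlt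
  rw [finiteRankTrace_rankOne, finiteRankTrace_rankOne, ne_eq, ← hiff]
  have key : ∀ a : ℂ, a ≠ 0 →
      (g + l) / 2 * (a * inner ℂ f x).re + (g - l) / 2 *
        √(‖a‖ ^ 2 * (‖x‖ ^ 2 * ‖f‖ ^ 2) - (a * inner ℂ f x).im ^ 2) =
      (g + l) / 2 * (a * inner ℂ h y).re + (g - l) / 2 *
        √(‖a‖ ^ 2 * (‖y‖ ^ 2 * ‖h‖ ^ 2) - (a * inner ℂ h y).im ^ 2) := by
    intro a ha
    have hmax := isGreatest_re_mul_cNumericalRange_rankOne h1 h2 h3 (f := f) hx ha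
    rw [hW] at hmax
    exact hmax.unique (isGreatest_re_mul_cNumericalRange_rankOne h1 h2 h3 hy ha)
  constructor
  · intro hp
    -- The square root is even in a, so the difference of `key` at a and -a isolates Re(aτ).
    have hre : ∀ a : ℂ, a ≠ 0 → (a * inner ℂ f x).re = (a * inner ℂ h y).re := by
      intro a ha
      have hpos := key a ha
      have hneg := key (-a) (neg_ne_zero.2 ha)
      simp only [neg_mul, Complex.neg_re, Complex.neg_im, neg_sq, norm_neg] at hneg
      refine mul_left_cancel₀ hp ?_
      linarith
    refine Complex.ext (by simpa using hre 1 one_ne_zero) ?_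
    simpa using hre Complex.I Complex.I_ne_zero
  · intro hp
    have bound : ∀ (a : ℂ) (x f : H),
        0 ≤ ‖a‖ ^ 2 * (‖x‖ ^ 2 * ‖f‖ ^ 2) - (a * inner ℂ f x).im ^ 2 := by
      intro a x f
      have hle : |(a * inner ℂ f x).im| ≤ ‖a‖ * (‖f‖ * ‖x‖) :=
        (Complex.abs_im_le_norm _).trans (by
          rw [norm_mul]
          exact mul_le_mul_of_nonneg_left (norm_inner_le_norm f x) (norm_nonneg a))
      have := sq_le_sq' (abs_le.1 hle).1 (abs_le.1 hle).2
      linarith [this, show (‖a‖ * (‖f‖ * ‖x‖)) ^ 2 = ‖a‖ ^ 2 * (‖x‖ ^ 2 * ‖f‖ ^ 2) by ring]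
    have hsq : ∀ a : ℂ, a ≠ 0 →
        ‖a‖ ^ 2 * (‖x‖ ^ 2 * ‖f‖ ^ 2) - (a * inner ℂ f x).im ^ 2 =
        ‖a‖ ^ 2 * (‖y‖ ^ 2 * ‖h‖ ^ 2) - (a * inner ℂ h y).im ^ 2 := by
      intro a ha
      have hq : (g - l) / 2 ≠ 0 := by linarith [hgl] |> fun h : 0 < (g - l) / 2 => h.ne'
      have := key a ha
      rw [hp, zero_div, zero_mul, zero_mul, zero_add, zero_add] at this
      exact (Real.sqrt_inj (bound a x f) (bound a y h)).1 (mul_left_cancel₀ hq this)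
    -- The directions 1, i and 1 + i give (Im τ)², (Re τ)² and (Re τ + Im τ)² up to the unknown
    -- norms, which cancel in the real and imaginary parts of τ².
    have hone := hsq 1 one_ne_zero
    have hI := hsq Complex.I Complex.I_ne_zero
    have hIone := hsq (1 + Complex.I) (fun h => by simpa using congrArg Complex.re h)
    have hn : ‖1 + Complex.I‖ ^ 2 = 2 := by
      rw [← Complex.normSq_eq_norm_sq, Complex.normSq_apply]; norm_num
    simp only [hn, norm_one, Complex.norm_I, one_pow, one_mul, Complex.mul_im, Complex.add_re,
      Complex.add_im, Complex.one_re, Complex.one_im, Complex.I_re, Complex.I_im, zero_mul,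
      zero_add, add_zero] at hone hI hIone
    refine sq_eq_sq_iff_eq_or_eq_neg.1 (Complex.ext ?_ ?_)
    · simp only [sq, Complex.mul_re]
      linarith
    · simp only [sq, Complex.mul_im]
      linarith
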